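/- For a simple graph $G$ on $n$ vertices with Laplacian matrix $L(G)=D(G)-A(G)$, let the Laplacian coefficients $c_0(G),\dots,c_n(G)$ be defined by $\det(\lambda I_n-L(G))=\sum_{k=0}^n(-1)^kc_k(G)\lambda^{n-k}$. For integers $n > d\ge 0$ let $C_{n,d}$ be the graph obtained from a path $v_0v_1\cdots v_d$ (with $d$ edges) by attaching $n-d-1$ pendent vertices to the central vertex $v_{\lfloor d/2\rfloor}$. **Theorem.** For $2\le d\le n-1$, the caterpillar $C_{n,d}$ is a tree on $n$ vertices with diameter $d$. If $T$ is any tree on $n$ vertices with diameter $d$, then $$c_k(C_{n,d})\le c_k(T)\qquad\text{for every } k=0,1,\dots,n.$$ Moreover, if $n\ge 3$, $S_n$ denotes the star on $n$ vertices and $P_n$ denotes the path on $n$ vertices, then for every $k=0,1,\dots,n$ $$c_k(S_n)=c_k(C_{n,2})\le c_k(C_{n,3})\le\cdots\le c_k(C_{n,n-2})\le c_k(C_{n,n-1})=c_k(P_n).$$ -/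

import Mathlib

open Classical in
/-- The `k`-th Laplacian coefficient `c_k(G)` of a finite simple graph on `n` vertices, defined by
`det (λ I - L(G)) = ∑_{k = 0}^n (-1)^k c_k(G) λ^(n-k)`, where `L(G)` is the Laplacian matrix.
It is meant for `k ≤ n`. -/
noncomputable def lapCoeff {V : Type*} [Fintype V] [DecidableEq V]
    (G : SimpleGraph V) (k : ℕ) : ℝ :=
  (-1) ^ k * (G.lapMatrix ℝ).charpoly.coeff (Fintype.card V - k)

/-- The caterpillar `C_{n,d}` (for `d + 1 ≤ n`) on the vertex set `{0, …, n - 1}`: the vertices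
`0, 1, …, d` form a path, in this order, and each of the remaining `n - d - 1` vertices
is joined only to the vertex `⌊d / 2⌋` of the path. -/
def caterpillar (n d : ℕ) : SimpleGraph (Fin n) :=
  SimpleGraph.fromRel fun i j : Fin n =>
    ((i : ℕ) + 1 = j ∧ (j : ℕ) ≤ d) ∨ ((i : ℕ) = d / 2 ∧ d < (j : ℕ))

/-!
# Caterpillars minimize the Laplacian coefficients

For a graph `G`, let `P(G) = det (X + L(G))`, whose coefficients are the Laplacian coefficients, and
let `Q(G, w)` be the principal minor of `X + L(G)` without the row and the column of `w`
(`lapPoly`, `rootPoly`). Polynomials are compared coefficientwise. If `G'` arises from `G` by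
attaching a pendent vertex `u` at `y`, then

* `P(G') = (X + 1) P(G) + X Q(G, y)`,
* `Q(G', u) = P(G) + Q(G, y)`, and `Q(G', y) = (X + 1) Q(G, y)`,
* `Q(G', w) = (X + 1) Q(G, w) + X Q(G; w, y)` for the other vertices `w`, where `Q(G; w, y)` is the
  minor without `w` and `y`.

As `L(G)` is positive semidefinite, `Q(G; w, y)` and `P(G) - X Q(G, y)` have nonnegative coefficients
(`Matrix.PosSemidef.det_diagonal_add_mem_nonnegCoeff`). So each new pendent vertex multiplies the
least `Q` by at least `X + 1`. For a caterpillar with its new vertex attached at the centre `c`, the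
polynomial `Q(·, c)` is multiplied by exactly `X + 1`. Hence if `P(G)` and all `Q(G, w)` dominate
`P` and `Q(·, c)` of a caterpillar, this remains so when a pendent vertex is attached to the
caterpillar at `c` and to `G` anywhere (`SimpleGraph.DominatesCaterpillar.addLeaf`).

A tree with a path of `d` edges grows from this path by attaching pendent vertices. For the path
itself, `Q` at the `i`-th vertex is a product `r i * r (d - i)`, where `r` satisfies a linear
recurrence of order two, and it is least in the middle
(`SimpleGraph.pathPolys_mul_sub_center_mem_nonnegCoeff`). Therefore every tree on `n` vertices that
contains a path with `d` edges has Laplacian coefficients at least those of `C_{n,d}`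
(`SimpleGraph.IsTree.lapCoeff_caterpillar_le`). This applies to the trees of diameter `d`, and it
also applies to `C_{n,d+1}`, which gives the chain of inequalities.
-/

open Polynomial

/-! ### Polynomials with nonnegative coefficients -/

/-- The subsemiring of real polynomials all of whose coefficients are nonnegative. Membership of
`q - p` is the coefficientwise order `p ≤ q`. -/
def nonnegCoeff : Subsemiring ℝ[X] where
  carrier := {p | ∀ k, 0 ≤ p.coeff k}
  zero_mem' := by simp
  one_mem' k := by rw [coeff_one]; split_ifs <;> simp
  add_mem' hp hq k := by rw [coeff_add]; exact add_nonneg (hp k) (hq k)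
  mul_mem' hp hq k := by
    rw [coeff_mul]; exact Finset.sum_nonneg fun x _ => mul_nonneg (hp _) (hq _)

theorem X_mem_nonnegCoeff : (X : ℝ[X]) ∈ nonnegCoeff := fun k => by
  rw [coeff_X]; split_ifs <;> simp

theorem X_add_one_mem_nonnegCoeff : (X + 1 : ℝ[X]) ∈ nonnegCoeff :=
  add_mem X_mem_nonnegCoeff (one_mem _)

theorem C_mem_nonnegCoeff {a : ℝ} (ha : 0 ≤ a) : C a ∈ nonnegCoeff := fun k => by
  rw [coeff_C]; split_ifs <;> simp [ha]

/-! ### Determinants -/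

namespace Matrix

section Option

variable {n R : Type*} [DecidableEq n] [CommRing R]

theorem det_option_of_row [Fintype n] (M : Matrix (Option n) (Option n) R)
    (h : ∀ j, M none (some j) = 0) :
    M.det = M none none * (M.submatrix some some).det := by
  rw [← det_submatrix_equiv_self (Equiv.optionEquivSumPUnit.{0} n).symm,
    ← fromBlocks_toBlocks (M.submatrix _ _)]
  have h21 : (M.submatrix (Equiv.optionEquivSumPUnit.{0} n).symm
      (Equiv.optionEquivSumPUnit.{0} n).symm).toBlocks₂₁ = 0 := by
    ext i j; simp [toBlocks₂₁, h]
  rw [h21, det_fromBlocks_zero₂₁, mul_comm]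
  congr 1
  simp [toBlocks₂₂]

theorem det_option_of_col [Fintype n] (M : Matrix (Option n) (Option n) R)
    (h : ∀ i, M (some i) none = 0) :
    M.det = M none none * (M.submatrix some some).det := by
  rw [← det_transpose, det_option_of_row Mᵀ h, transpose_apply, ← det_transpose (M.submatrix _ _),
    transpose_submatrix]

/-- The matrix on `Option n` obtained from `B` by joining a new index `none` to `y` by an edge of
weight one and adding `a` at the diagonal entry of the new index. If `B = X + L(G)`, this is
`X + L(G')` for `a = X` and the graph `G'` which arises from `G` by attaching a pendent vertex
at `y`. -/
def attach (a : R) (B : Matrix n n R) (y : n) : Matrix (Option n) (Option n) R :=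
  of fun
    | none, none => a + 1
    | none, some j => if j = y then -1 else 0
    | some i, none => if i = y then -1 else 0
    | some i, some j => B i j + if i = y ∧ j = y then 1 else 0

theorem attach_updateRow_of_ne (a : R) (B : Matrix n n R) {w y : n} (h : w ≠ y) :
    (attach a B y).updateRow (some w) (Pi.single (some w) 1) =
      attach a (B.updateRow w (Pi.single w 1)) y := by
  ext i j
  rcases i with _ | i
  · cases j <;> simp [attach]
  · by_cases hi : i = w
    · subst hi
      rcases j with _ | j <;> simp [attach, h, Pi.single_apply]
    · rcases j with _ | j <;> simp [attach, hi]

theorem attach_updateRow_submatrix (a : R) (B : Matrix n n R) (y : n) :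
    ((attach a B y).updateRow (some y) (Pi.single (some y) 1)).submatrix some some =
      B.updateRow y (Pi.single y 1) := by
  ext i j
  by_cases hi : i = y
  · subst hi; simp [Pi.single_apply]
  · simp [attach, hi]

variable [Fintype n]

/-- Deleting the new vertex leaves `B` with its diagonal entry at `y` increased by one. -/
theorem attach_submatrix_some (a : R) (B : Matrix n n R) (y : n) :
    ((attach a B y).submatrix some some).det = B.det + B.adjugate y y := by
  rw [adjugate_apply]
  conv_rhs => rw [← updateRow_eq_self B y]
  rw [updateRow_idem, ← det_updateRow_add]
  congr 1
  ext i j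
  by_cases hi : i = y
  · subst hi
    simp [attach, Pi.single_apply]
  · simp [attach, hi]

theorem det_attach (a : R) (B : Matrix n n R) (y : n) :
    (attach a B y).det = (a + 1) * B.det + a * B.adjugate y y := by
  -- the new row is `a • e + (e - f)`, for the unit vectors `e` and `f` of `none` and `some y`
  have hrow : attach a B y = (attach a B y).updateRow none
      (a • Pi.single none 1 + (fun j => if j = some y then -1 else if j = none then 1 else 0)) := by
    ext i j
    cases i <;> cases j <;> simp [attach]
  have h1 : ((attach a B y).updateRow none (Pi.single none 1)).det =
      B.det + B.adjugate y y := by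
    rw [det_option_of_row _ (by simp), ← attach_submatrix_some a]
    simp only [updateRow_self, Pi.single_eq_same, one_mul]
    congr 1
  have h2 : ((attach a B y).updateRow none
      (fun j => if j = some y then -1 else if j = none then 1 else 0)).det = B.det := by
    -- adding the new row to row `y` clears the new column
    rw [← det_updateRow_add_self _ (Option.some_ne_none y), det_option_of_col]
    · rw [updateRow_ne (Option.some_ne_none y).symm, updateRow_self]
      simp only [reduceCtorEq, ↓reduceIte, one_mul]
      congr 1
      ext i j
      by_cases hi : i = y
      · subst hi
        by_cases hj : j = i <;> simp [attach, hj]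
      · simp [attach, hi]
    · intro i
      by_cases hi : i = y
      · subst hi; simp [attach]
      · simp [attach, hi]
  rw [hrow, det_updateRow_add, det_updateRow_smul, h1, h2]
  ring

theorem adjugate_attach_none (a : R) (B : Matrix n n R) (y : n) :
    (attach a B y).adjugate none none = B.det + B.adjugate y y := by
  rw [adjugate_apply, det_option_of_row _ (by simp), ← attach_submatrix_some a]
  simp only [updateRow_self, Pi.single_eq_same, one_mul]
  congr 1

theorem adjugate_attach_some_of_ne (a : R) (B : Matrix n n R) {w y : n} (h : w ≠ y) :
    (attach a B y).adjugate (some w) (some w) = (a + 1) * B.adjugate w w +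
      a * (B.updateRow w (Pi.single w 1)).adjugate y y := by
  rw [adjugate_apply, attach_updateRow_of_ne a B h, det_attach, adjugate_apply B]

theorem adjugate_attach_some_self (a : R) (B : Matrix n n R) (y : n) :
    (attach a B y).adjugate (some y) (some y) = (a + 1) * B.adjugate y y := by
  rw [adjugate_apply, det_option_of_col, attach_updateRow_submatrix, adjugate_apply]
  · simp [attach]
  · intro i
    by_cases hi : i = y
    · subst hi; simp
    · simp [attach, hi]

theorem adjugate_updateRow_attach_none_of_ne (a : R) (B : Matrix n n R) {w y : n} (h : w ≠ y) :
    ((attach a B y).updateRow (some w) (Pi.single (some w) 1)).adjugate none none =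
      B.adjugate w w + (B.updateRow w (Pi.single w 1)).adjugate y y := by
  rw [attach_updateRow_of_ne a B h, adjugate_attach_none, adjugate_apply B]

theorem adjugate_updateRow_attach_none_self (a : R) (B : Matrix n n R) (y : n) :
    ((attach a B y).updateRow (some y) (Pi.single (some y) 1)).adjugate none none =
      B.adjugate y y := by
  rw [adjugate_apply, det_option_of_row _ (by simp), adjugate_apply,
    ← attach_updateRow_submatrix a B y]
  simp only [updateRow_self, Pi.single_eq_same, one_mul]
  congr 1

end Option

variable {V : Type*} [Fintype V] [DecidableEq V]

/-- A determinant in which some rows are rows of the identity matrix is a principal minor. -/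
theorem det_ite_one {R : Type*} [CommRing R] (A : Matrix V V R) (p : V → Prop) [DecidablePred p] :
    (of fun i j => if p i then (1 : Matrix V V R) i j else A i j).det =
      (A.submatrix (fun i : {i // ¬ p i} => (i : V)) (fun i : {i // ¬ p i} => (i : V))).det := by
  rw [twoBlockTriangular_det' _ p]
  · have h1 : toSquareBlockProp (of fun i j => if p i then (1 : Matrix V V R) i j else A i j)
        p = 1 := by
      ext i j
      simp [toSquareBlockProp, i.2, one_apply, Subtype.ext_iff]
    rw [h1, det_one, one_mul]
    congr 1
    ext i j
    simp only [toSquareBlockProp, toBlock_apply, of_apply, submatrix_apply, if_neg i.2]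
  · intro i hi j hj
    have : i ≠ j := fun h => hj (h ▸ hi)
    simp [hi, this]

/-- Let `A` be positive semidefinite and `d` a diagonal of polynomials with nonnegative
coefficients. Replace the rows of `d + A` in `t` by rows of the identity. By multilinearity in the
rows, the determinant is a sum of products of entries of `d` with principal minors of `A`, and
so it has nonnegative coefficients. -/
theorem PosSemidef.det_diagonal_add_mem_nonnegCoeff {A : Matrix V V ℝ} (hA : A.PosSemidef)
    {d : V → ℝ[X]} (hd : ∀ i, d i ∈ nonnegCoeff) (t : Finset V) :
    (of fun i j => if i ∈ t then (1 : Matrix V V ℝ[X]) i j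
      else diagonal d i j + C (A i j)).det ∈ nonnegCoeff := by
  have key := (detRowAlternating (n := V) (R := ℝ[X])).toMultilinearMap.map_add_univ
    (fun i => (if i ∈ t then 1 else d i) • (1 : Matrix V V ℝ[X]) i)
    (fun i j => if i ∈ t then 0 else C (A i j))
  have hM : (of fun i j => if i ∈ t then (1 : Matrix V V ℝ[X]) i j
      else diagonal d i j + C (A i j)) = (fun i => (if i ∈ t then 1 else d i) •
        (1 : Matrix V V ℝ[X]) i) + (fun i j => if i ∈ t then 0 else C (A i j)) := by
    ext1 i j
    by_cases hi : i ∈ t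
    · simp [hi]
    · simp [hi, diagonal_apply, one_apply]
  rw [hM]
  refine (congrArg (· ∈ nonnegCoeff) key).mpr (sum_mem fun s _ => ?_)
  -- the summand of `s` takes the rows in `s` from the diagonal part and the others from `A`;
  -- if `s` does not contain `t`, it has a zero row
  by_cases hts : t ⊆ s
  · have hrow : (s.piecewise (fun i => (if i ∈ t then 1 else d i) • (1 : Matrix V V ℝ[X]) i)
        (fun i j => if i ∈ t then 0 else C (A i j))) =
        fun i => (if i ∈ s then (if i ∈ t then 1 else d i) else 1) •
          (if i ∈ s then (1 : Matrix V V ℝ[X]) i else fun j => C (A i j)) := by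
      ext1 i
      by_cases hi : i ∈ s
      · simp [hi]
      · have : i ∉ t := fun h => hi (hts h)
        simp [hi, this]
    rw [hrow, MultilinearMap.map_smul_univ, smul_eq_mul]
    refine mul_mem (prod_mem fun i _ => ?_) ?_
    · split_ifs
      exacts [one_mem _, hd i, one_mem _]
    · have := det_ite_one (A.map C) (· ∈ s)
      have h2 : (detRowAlternating (n := V) (R := ℝ[X])).toMultilinearMap
          (fun i => if i ∈ s then (1 : Matrix V V ℝ[X]) i else fun j => C (A i j)) =
          (of fun i j => if i ∈ s then (1 : Matrix V V ℝ[X]) i j else A.map C i j).det := by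
        change det _ = _
        congr 1
        ext1 i j
        by_cases hi : i ∈ s <;> simp [hi]
      rw [h2, this, submatrix_map, ← RingHom.mapMatrix_apply, ← RingHom.map_det]
      exact C_mem_nonnegCoeff (hA.submatrix _).det_nonneg
  · obtain ⟨i, hit, his⟩ := Finset.not_subset.mp hts
    rw [MultilinearMap.map_coord_zero _ i]
    · exact zero_mem _
    · ext1 j
      simp [his, hit]

end Matrix

/-! ### The polynomials of a graph -/

namespace SimpleGraph

section Polynomials

variable {V W : Type*} [Fintype V] [DecidableEq V] [Fintype W] [DecidableEq W]

open Classical in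
/-- The matrix `X + L(G)`, where `L(G)` is the Laplacian matrix of `G`. -/
noncomputable def shiftedLap (G : SimpleGraph V) : Matrix V V ℝ[X] :=
  Matrix.of fun i j => if i = j then X + ∑ k, (if G.Adj i k then 1 else 0)
    else if G.Adj i j then -1 else 0

/-- The polynomial `det (X + L(G))`. Its coefficients are the Laplacian coefficients of `G`. -/
noncomputable def lapPoly (G : SimpleGraph V) : ℝ[X] := G.shiftedLap.det

/-- The principal minor of `X + L(G)` in which the row and the column of `w` are deleted, written
as an adjugate entry. -/
noncomputable def rootPoly (G : SimpleGraph V) (w : V) : ℝ[X] := G.shiftedLap.adjugate w w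

/-- For `w ≠ y`, the principal minor of `X + L(G)` in which the rows and columns of `w` and `y`
are deleted. (For `w = y` it is `G.rootPoly w`.) -/
noncomputable def rootPoly₂ (G : SimpleGraph V) (w y : V) : ℝ[X] :=
  (G.shiftedLap.updateRow w (Pi.single w 1)).adjugate y y

open Classical in
theorem shiftedLap_apply (G : SimpleGraph V) (i j : V) :
    G.shiftedLap i j = Matrix.diagonal (fun _ => X) i j + C (G.lapMatrix ℝ i j) := by
  by_cases h : i = j
  · subst h
    simp [shiftedLap, lapMatrix, degMatrix, degree_eq_sum_if_adj]
  · by_cases hG : G.Adj i j <;> simp [shiftedLap, lapMatrix, degMatrix, h, hG]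

open Classical in
theorem lapCoeff_eq_coeff (G : SimpleGraph V) {k : ℕ} (hk : k ≤ Fintype.card V) :
    lapCoeff G k = G.lapPoly.coeff (Fintype.card V - k) := by
  -- `det (X + L) = (-1) ^ n * det (-X - L)`, so the coefficients differ from those of the
  -- characteristic polynomial by signs only
  have h1 : G.lapPoly = (-1) ^ Fintype.card V * ((G.lapMatrix ℝ).charpoly.comp (-X)) := by
    have h2 : ((G.lapMatrix ℝ).charpoly.comp (-X)) =
        (-G.shiftedLap).det := by
      rw [Matrix.charpoly, ← coe_compRingHom_apply, RingHom.map_det]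
      congr 1
      ext1 i j
      rw [Matrix.neg_apply, shiftedLap_apply, RingHom.mapMatrix_apply, Matrix.map_apply,
        Matrix.charmatrix_apply]
      by_cases h : i = j
      · subst h; simp [coe_compRingHom_apply]; ring
      · simp [coe_compRingHom_apply, h]
    rw [h2, Matrix.det_neg, ← mul_assoc, ← mul_pow]
    simp [lapPoly]
  have hcomp : ∀ (p : ℝ[X]) (m : ℕ), (p.comp (-X)).coeff m = (-1) ^ m * p.coeff m := by
    intro p m
    have : (-X : ℝ[X]) = C (-1) * X := by simp
    rw [this, comp_C_mul_X_coeff, mul_comm]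
  have hC : ((-1 : ℝ[X]) ^ Fintype.card V) = C ((-1) ^ Fintype.card V) := by simp
  rw [h1, hC, coeff_C_mul, hcomp, lapCoeff, ← mul_assoc, ← pow_add]
  congr 1
  obtain ⟨m, hm⟩ := Nat.exists_eq_add_of_le hk
  rw [hm, Nat.add_sub_cancel_left, add_assoc, ← two_mul, pow_add, pow_mul]
  simp

theorem shiftedLap_iso {G : SimpleGraph V} {H : SimpleGraph W} (e : G ≃g H) :
    H.shiftedLap.submatrix e.toEquiv e.toEquiv = G.shiftedLap := by
  classical
  ext1 i j
  simp only [shiftedLap, Matrix.submatrix_apply, Matrix.of_apply, EmbeddingLike.apply_eq_iff_eq]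
  rw [← Equiv.sum_comp e.toEquiv]
  simp [e.map_adj_iff]

theorem lapPoly_iso {G : SimpleGraph V} {H : SimpleGraph W} (e : G ≃g H) :
    G.lapPoly = H.lapPoly := by
  rw [lapPoly, ← shiftedLap_iso e, Matrix.det_submatrix_equiv_self, lapPoly]

theorem lapCoeff_iso {G : SimpleGraph V} {H : SimpleGraph W} (e : G ≃g H) {k : ℕ}
    (hk : k ≤ Fintype.card V) :
    lapCoeff G k = lapCoeff H k := by
  have hcard : Fintype.card V = Fintype.card W := Fintype.card_congr e.toEquiv
  rw [lapCoeff_eq_coeff G hk, lapCoeff_eq_coeff H (hcard ▸ hk), lapPoly_iso e, hcard]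

theorem rootPoly_iso {G : SimpleGraph V} {H : SimpleGraph W} (e : G ≃g H) (w : V) :
    G.rootPoly w = H.rootPoly (e w) := by
  rw [rootPoly, ← shiftedLap_iso e, Matrix.adjugate_submatrix_equiv_self]
  rfl

theorem rootPoly₂_iso {G : SimpleGraph V} {H : SimpleGraph W} (e : G ≃g H) (w y : V) :
    G.rootPoly₂ w y = H.rootPoly₂ (e w) (e y) := by
  have : (H.shiftedLap.updateRow (e w) (Pi.single (e w) 1)).submatrix e.toEquiv e.toEquiv =
      G.shiftedLap.updateRow w (Pi.single w 1) := by
    rw [← shiftedLap_iso e]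
    ext1 i j
    by_cases hi : i = w
    · subst hi
      simp [Pi.single_apply]
    · simp [Matrix.updateRow_apply, hi]
  rw [rootPoly₂, ← this, Matrix.adjugate_submatrix_equiv_self]
  rfl

theorem rootPoly₂_mem_nonnegCoeff (G : SimpleGraph V) {w y : V} :
    G.rootPoly₂ w y ∈ nonnegCoeff := by
  classical
  have := (posSemidef_lapMatrix ℝ G).det_diagonal_add_mem_nonnegCoeff
    (d := fun _ => X) (fun _ => X_mem_nonnegCoeff) {w, y}
  rw [rootPoly₂, Matrix.adjugate_apply]
  convert this using 2
  ext1 i j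
  by_cases hy : i = y
  · subst hy
    simp [Pi.single_apply, Matrix.one_apply, eq_comm]
  · by_cases hw : i = w
    · subst hw
      simp [Matrix.updateRow_apply, hy, Pi.single_apply, Matrix.one_apply, eq_comm]
    · simp [Matrix.updateRow_apply, hy, hw, shiftedLap_apply]

/-- Coefficientwise, `X * G.rootPoly y ≤ G.lapPoly`: the difference is the determinant of
`D + L(G)`, where `D` is `X` on the diagonal, except for the entry `0` at `y`. -/
theorem lapPoly_sub_X_mul_rootPoly_mem_nonnegCoeff (G : SimpleGraph V) (y : V) :
    G.lapPoly - X * G.rootPoly y ∈ nonnegCoeff := by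
  classical
  have := (posSemidef_lapMatrix ℝ G).det_diagonal_add_mem_nonnegCoeff
    (d := fun i => if i = y then 0 else X)
    (fun i => by split_ifs; exacts [zero_mem _, X_mem_nonnegCoeff]) ∅
  convert this using 1
  rw [lapPoly, rootPoly, Matrix.adjugate_apply, ← Matrix.det_updateRow_smul]
  rw [sub_eq_iff_eq_add]
  have h : G.shiftedLap = G.shiftedLap.updateRow y
      ((fun j => C (G.lapMatrix ℝ y j)) + (X : ℝ[X]) • Pi.single y 1) := by
    ext1 i j
    by_cases hi : i = y
    · subst hi
      simp [shiftedLap_apply, Matrix.diagonal_apply, Pi.single_apply, eq_comm, add_comm]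
    · simp [hi]
  conv_lhs => rw [h]
  rw [Matrix.det_updateRow_add]
  congr 2
  ext1 i j
  by_cases hi : i = y
  · subst hi
    simp [Matrix.diagonal_apply]
  · simp [hi, shiftedLap_apply, Matrix.diagonal_apply]

end Polynomials

/-! ### Attaching a pendent vertex -/

/-- The graph on `Option V` obtained from `G` by joining the new vertex `none` to `y` only. -/
def addLeaf {V : Type*} (G : SimpleGraph V) (y : V) : SimpleGraph (Option V) where
  Adj
    | none, none => False
    | none, some j => j = y
    | some i, none => i = y
    | some i, some j => G.Adj i j
  symm.symm := by
    rintro (_ | i) (_ | j) h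
    exacts [h, h, h, h.symm]
  loopless.irrefl := by
    rintro (_ | i) h
    exacts [h, G.loopless.irrefl i h]

section AddLeaf

variable {V : Type*} (G : SimpleGraph V) (y : V)

@[simp] theorem addLeaf_adj_none_none : ¬ (G.addLeaf y).Adj none none := id

@[simp] theorem addLeaf_adj_none_some {j : V} : (G.addLeaf y).Adj none (some j) ↔ j = y := Iff.rfl

@[simp] theorem addLeaf_adj_some_none {i : V} : (G.addLeaf y).Adj (some i) none ↔ i = y := Iff.rfl

@[simp] theorem addLeaf_adj_some_some {i j : V} :
    (G.addLeaf y).Adj (some i) (some j) ↔ G.Adj i j := Iff.rfl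

variable [Fintype V] [DecidableEq V]

theorem shiftedLap_addLeaf :
    (G.addLeaf y).shiftedLap = Matrix.attach X G.shiftedLap y := by
  classical
  ext1 i j
  rcases i with _ | i <;> rcases j with _ | j
  · simp [shiftedLap, Matrix.attach, -Finset.sum_boole]
  · simp [shiftedLap, Matrix.attach]
  · simp [shiftedLap, Matrix.attach]
  · by_cases h : i = j
    · subst h
      simp only [shiftedLap, Matrix.attach, Matrix.of_apply, Fintype.sum_option]
      simp only [addLeaf_adj_some_none, addLeaf_adj_some_some, if_true, and_self]
      ring
    · have : ¬ (i = y ∧ j = y) := fun hh => h (hh.1.trans hh.2.symm)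
      simp [shiftedLap, Matrix.attach, h, this]

theorem lapPoly_addLeaf :
    (G.addLeaf y).lapPoly = (X + 1) * G.lapPoly + X * G.rootPoly y := by
  rw [lapPoly, shiftedLap_addLeaf, Matrix.det_attach, lapPoly, rootPoly]

theorem rootPoly_addLeaf_none :
    (G.addLeaf y).rootPoly none = G.lapPoly + G.rootPoly y := by
  rw [rootPoly, shiftedLap_addLeaf, Matrix.adjugate_attach_none, lapPoly, rootPoly]

theorem rootPoly_addLeaf_some_of_ne {w : V} (h : w ≠ y) :
    (G.addLeaf y).rootPoly (some w) = (X + 1) * G.rootPoly w + X * G.rootPoly₂ w y := by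
  rw [rootPoly, shiftedLap_addLeaf, Matrix.adjugate_attach_some_of_ne _ _ h, rootPoly, rootPoly₂]

theorem rootPoly_addLeaf_some_self :
    (G.addLeaf y).rootPoly (some y) = (X + 1) * G.rootPoly y := by
  rw [rootPoly, shiftedLap_addLeaf, Matrix.adjugate_attach_some_self, rootPoly]

theorem rootPoly₂_addLeaf_none_of_ne {w : V} (h : w ≠ y) :
    (G.addLeaf y).rootPoly₂ (some w) none = G.rootPoly w + G.rootPoly₂ w y := by
  rw [rootPoly₂, shiftedLap_addLeaf, Matrix.adjugate_updateRow_attach_none_of_ne _ _ h,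
    rootPoly, rootPoly₂]

theorem rootPoly₂_addLeaf_none_self :
    (G.addLeaf y).rootPoly₂ (some y) none = G.rootPoly y := by
  rw [rootPoly₂, shiftedLap_addLeaf, Matrix.adjugate_updateRow_attach_none_self, rootPoly]

/-- Attaching a pendent vertex multiplies each `rootPoly` by at least `X + 1`, coefficientwise.
Here the polynomial of `G` is taken at the neighbour `y` if `w` is the new vertex. -/
theorem rootPoly_addLeaf_sub_mem_nonnegCoeff (w : Option V) :
    (G.addLeaf y).rootPoly w - (X + 1) * G.rootPoly (w.getD y) ∈ nonnegCoeff := by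
  rcases w with _ | w
  · rw [rootPoly_addLeaf_none]
    convert G.lapPoly_sub_X_mul_rootPoly_mem_nonnegCoeff y using 1
    simp only [Option.getD_none]
    ring
  · by_cases h : w = y
    · subst h
      rw [rootPoly_addLeaf_some_self]
      simp
    · rw [rootPoly_addLeaf_some_of_ne _ _ h]
      convert mul_mem X_mem_nonnegCoeff (G.rootPoly₂_mem_nonnegCoeff (w := w) (y := y)) using 1
      simp only [Option.getD_some]
      ring

end AddLeaf

end SimpleGraph

/-! ### Paths and caterpillars -/

namespace SimpleGraph

/-- The graph isomorphism onto `G` given by a bijection `e : Option W ≃ V` that identifies `G` with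
`H` plus a pendent vertex at `y`. -/
def addLeafIso {V W : Type*} {G : SimpleGraph V} {H : SimpleGraph W} (e : Option W ≃ V) (y : W)
    (hsome : ∀ i j, G.Adj (e (some i)) (e (some j)) ↔ H.Adj i j)
    (hnone : ∀ j, G.Adj (e none) (e (some j)) ↔ j = y) : H.addLeaf y ≃g G where
  toEquiv := e
  map_rel_iff' := by
    rintro (_ | i) (_ | j)
    · simp
    · simp [hnone]
    · simp [adj_comm, hnone]
    · simp [hsome]

/-- A path graph arises from a shorter one by attaching its last vertex. -/
def pathGraphIso (n : ℕ) : (pathGraph (n + 1)).addLeaf (Fin.last n) ≃g pathGraph (n + 2) :=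
  addLeafIso finSuccEquivLast.symm _ (by simp [pathGraph_adj])
    (by intro j; simp only [finSuccEquivLast_symm_none, finSuccEquivLast_symm_some, pathGraph_adj,
          Fin.ext_iff, Fin.val_last, Fin.val_castSucc]; omega)

theorem caterpillar_adj {n d : ℕ} {i j : Fin n} : (caterpillar n d).Adj i j ↔
    ((i : ℕ) + 1 = j ∧ (j : ℕ) ≤ d) ∨ ((i : ℕ) = d / 2 ∧ d < (j : ℕ)) ∨
    ((j : ℕ) + 1 = i ∧ (i : ℕ) ≤ d) ∨ ((j : ℕ) = d / 2 ∧ d < (i : ℕ)) := by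
  simp only [caterpillar, fromRel_adj, ne_eq, Fin.ext_iff]
  omega

theorem caterpillar_eq_pathGraph (d : ℕ) : caterpillar (d + 1) d = pathGraph (d + 1) := by
  ext i j
  rw [caterpillar_adj, pathGraph_adj]
  omega

/-- A caterpillar arises from a smaller one by attaching a pendent vertex at the centre. -/
def caterpillarIso (d k : ℕ) :
    (caterpillar (d + 1 + k) d).addLeaf ⟨d / 2, by omega⟩ ≃g caterpillar (d + 1 + (k + 1)) d :=
  addLeafIso (finSuccEquivLast (n := d + 1 + k)).symm _
    (by intro i j; simp only [finSuccEquivLast_symm_some, caterpillar_adj, Fin.val_castSucc])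
    (by intro j; simp only [finSuccEquivLast_symm_none, finSuccEquivLast_symm_some,
          caterpillar_adj, Fin.ext_iff, Fin.val_last, Fin.val_castSucc]; omega)

/-- The polynomials `(r m, g m)` describing paths: `r m` is the `rootPoly` of the path with `m`
edges at one of its ends, and `X * g (m + 1)` is its `lapPoly`. -/
noncomputable def pathPolys : ℕ → ℝ[X] × ℝ[X]
  | 0 => (1, 0)
  | m + 1 => ((X + 1) * (pathPolys m).1 + X * (pathPolys m).2, (pathPolys m).1 + (pathPolys m).2)

/-- Attaching a pendent vertex at the end of a path transforms the pair of `lapPoly` and end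
`rootPoly` by the recursion of `pathPolys`. -/
theorem lapPoly_rootPoly_pathGraph (m : ℕ) :
    (pathGraph (m + 1)).lapPoly = X * (pathPolys (m + 1)).2 ∧
      (pathGraph (m + 1)).rootPoly (Fin.last m) = (pathPolys m).1 := by
  induction m with
  | zero =>
    constructor
    · simp [lapPoly, pathPolys, shiftedLap]
    · simp [rootPoly, pathPolys, Matrix.adjugate_fin_one]
  | succ m ih =>
    rw [← lapPoly_iso (pathGraphIso m), lapPoly_addLeaf]
    have : Fin.last (m + 1) = pathGraphIso m none := by
      simp [pathGraphIso, addLeafIso]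
    rw [this, ← rootPoly_iso, rootPoly_addLeaf_none, ih.1, ih.2]
    simp only [pathPolys]
    constructor <;> ring

/-- The product formula for an inner vertex `i` of the path, by induction on the number of edges
after `i`, together with the minor in which the last vertex is deleted as well. -/
theorem rootPoly_rootPoly₂_pathGraph (i m : ℕ) :
    (pathGraph (i + m + 2)).rootPoly ⟨i, by omega⟩ = (pathPolys i).1 * (pathPolys (m + 1)).1 ∧
    (pathGraph (i + m + 2)).rootPoly₂ ⟨i, by omega⟩ (Fin.last _) =
      (pathPolys i).1 * (pathPolys (m + 1)).2 := by
  induction m with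
  | zero =>
    have h1 : (⟨i, by omega⟩ : Fin (i + 2)) = pathGraphIso i (some (Fin.last i)) := by
      simp [pathGraphIso, addLeafIso]
      rfl
    have h2 : Fin.last (i + 1) = pathGraphIso i none := by
      simp [pathGraphIso, addLeafIso]
    change (pathGraph (i + 2)).rootPoly ⟨i, _⟩ = _ ∧
      (pathGraph (i + 2)).rootPoly₂ ⟨i, _⟩ (Fin.last (i + 1)) = _
    rw [h1, h2, ← rootPoly_iso, ← rootPoly₂_iso, rootPoly_addLeaf_some_self,
      rootPoly₂_addLeaf_none_self, (lapPoly_rootPoly_pathGraph i).2]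
    simp only [pathPolys]
    constructor <;> ring
  | succ m ih =>
    have h1 : (⟨i, by omega⟩ : Fin (i + m + 1 + 2)) =
        pathGraphIso (i + m + 1) (some ⟨i, by omega⟩) := by
      simp [pathGraphIso, addLeafIso]
    have h2 : Fin.last (i + m + 1 + 1) = pathGraphIso (i + m + 1) none := by
      simp [pathGraphIso, addLeafIso]
    have hne : (⟨i, by omega⟩ : Fin (i + m + 2)) ≠ Fin.last (i + m + 1) := by
      simp only [ne_eq, Fin.ext_iff, Fin.val_last]; omega
    change (pathGraph (i + m + 1 + 2)).rootPoly ⟨i, _⟩ = _ ∧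
      (pathGraph (i + m + 1 + 2)).rootPoly₂ ⟨i, _⟩ (Fin.last (i + m + 1 + 1)) = _
    rw [h1, h2, ← rootPoly_iso, ← rootPoly₂_iso, rootPoly_addLeaf_some_of_ne _ _ hne,
      rootPoly₂_addLeaf_none_of_ne _ _ hne, ih.1, ih.2]
    rw [pathPolys.eq_2 (m + 1)]
    constructor <;> ring

/-- Deleting an inner vertex of a path leaves two paths, and so `rootPoly` factors. -/
theorem rootPoly_pathGraph {d i : ℕ} (h : i ≤ d) :
    (pathGraph (d + 1)).rootPoly ⟨i, by omega⟩ = (pathPolys i).1 * (pathPolys (d - i)).1 := by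
  obtain ⟨m, rfl⟩ := Nat.exists_eq_add_of_le h
  rw [Nat.add_sub_cancel_left]
  rcases m with _ | m
  · rw [show (pathPolys 0).1 = 1 from rfl, mul_one]
    exact (lapPoly_rootPoly_pathGraph i).2
  · exact (rootPoly_rootPoly₂_pathGraph i m).1

theorem pathPolys_mem_nonnegCoeff (m : ℕ) :
    (pathPolys m).1 ∈ nonnegCoeff ∧ (pathPolys m).2 ∈ nonnegCoeff := by
  induction m with
  | zero => exact ⟨one_mem _, zero_mem _⟩
  | succ m ih =>
    exact ⟨add_mem (mul_mem X_add_one_mem_nonnegCoeff ih.1) (mul_mem X_mem_nonnegCoeff ih.2),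
      add_mem ih.1 ih.2⟩

/-- The sequence `r` satisfies a linear recurrence whose transfer matrix has determinant one, so
this difference only depends on `b`. -/
theorem pathPolys_mul_sub (a b : ℕ) :
    (pathPolys a).1 * (pathPolys (a + b + 1)).1 - (pathPolys (a + 1)).1 * (pathPolys (a + b)).1 =
      X * (pathPolys b).2 := by
  induction a with
  | zero => simp only [zero_add, pathPolys]; ring
  | succ a ih =>
    rw [← ih, show a + 1 + b = a + b + 1 by omega]
    simp only [pathPolys]
    ring

theorem pathPolys_mul_sub_mem_nonnegCoeff_of_le {d i j : ℕ} (hij : i ≤ j) (hj : j ≤ d / 2) :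
    (pathPolys i).1 * (pathPolys (d - i)).1 - (pathPolys j).1 * (pathPolys (d - j)).1 ∈
      nonnegCoeff := by
  induction j, hij using Nat.le_induction with
  | base => simp
  | succ j hij ih =>
    have h := pathPolys_mul_sub j (d - j - 1 - j)
    rw [show j + (d - j - 1 - j) + 1 = d - j by omega,
      show j + (d - j - 1 - j) = d - (j + 1) by omega] at h
    have h2 := add_mem (ih (by omega))
      (mul_mem X_mem_nonnegCoeff (pathPolys_mem_nonnegCoeff (d - j - 1 - j)).2)
    rw [← h] at h2
    convert h2 using 1
    ring

/-- Among the vertices of a path, a central one has the smallest `rootPoly`. -/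
theorem pathPolys_mul_sub_center_mem_nonnegCoeff {d i : ℕ} (hi : i ≤ d) :
    (pathPolys i).1 * (pathPolys (d - i)).1 -
      (pathPolys (d / 2)).1 * (pathPolys (d - d / 2)).1 ∈ nonnegCoeff := by
  rcases le_total i (d / 2) with h | h
  · exact pathPolys_mul_sub_mem_nonnegCoeff_of_le h le_rfl
  · rcases h.eq_or_lt with rfl | h
    · simp
    · have := pathPolys_mul_sub_mem_nonnegCoeff_of_le (d := d) (i := d - i) (j := d / 2)
        (by omega) le_rfl
      rwa [show d - (d - i) = i by omega, mul_comm (pathPolys (d - i)).1] at this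

/-- The `rootPoly` at the central vertex of the caterpillar with `k` pendent vertices attached to
the path with `d` edges. -/
noncomputable def caterpillarRootPoly (d k : ℕ) : ℝ[X] :=
  (X + 1) ^ k * ((pathPolys (d / 2)).1 * (pathPolys (d - d / 2)).1)

theorem lapPoly_caterpillar_succ (d k : ℕ) : (caterpillar (d + 1 + (k + 1)) d).lapPoly =
    (X + 1) * (caterpillar (d + 1 + k) d).lapPoly +
      X * (caterpillar (d + 1 + k) d).rootPoly ⟨d / 2, by omega⟩ := by
  rw [← lapPoly_iso (caterpillarIso d k), lapPoly_addLeaf]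

theorem rootPoly_caterpillar (d k : ℕ) :
    (caterpillar (d + 1 + k) d).rootPoly ⟨d / 2, by omega⟩ = caterpillarRootPoly d k := by
  induction k with
  | zero =>
    change (caterpillar (d + 1) d).rootPoly ⟨d / 2, _⟩ = _
    rw [caterpillar_eq_pathGraph, rootPoly_pathGraph (by omega), caterpillarRootPoly]
    simp
  | succ k ih =>
    have : (⟨d / 2, by omega⟩ : Fin (d + 1 + (k + 1))) =
        caterpillarIso d k (some ⟨d / 2, by omega⟩) := by
      simp [caterpillarIso, addLeafIso]
    rw [this, ← rootPoly_iso, rootPoly_addLeaf_some_self, ih, caterpillarRootPoly,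
      caterpillarRootPoly]
    ring

/-! ### Comparison with caterpillars -/

section Dominates

variable {V W : Type*} [Fintype V] [DecidableEq V] [Fintype W] [DecidableEq W]

/-- Coefficientwise, the polynomials of `G` are at least those of the caterpillar with `k` pendent
vertices attached to the path with `d` edges: this concerns `lapPoly` and, for every vertex of
`G`, the comparison of `rootPoly` with that at the central vertex of the caterpillar. -/
def DominatesCaterpillar (d k : ℕ) (G : SimpleGraph V) : Prop :=
  G.lapPoly - (caterpillar (d + 1 + k) d).lapPoly ∈ nonnegCoeff ∧
    ∀ w, G.rootPoly w - caterpillarRootPoly d k ∈ nonnegCoeff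

theorem DominatesCaterpillar.iso {d k : ℕ} {G : SimpleGraph V} {H : SimpleGraph W}
    (h : G.DominatesCaterpillar d k) (e : G ≃g H) : H.DominatesCaterpillar d k := by
  refine ⟨lapPoly_iso e ▸ h.1, fun w => ?_⟩
  rw [rootPoly_iso e.symm]
  exact h.2 _

theorem dominatesCaterpillar_pathGraph (d : ℕ) :
    (pathGraph (d + 1)).DominatesCaterpillar d 0 := by
  constructor
  · rw [add_zero, caterpillar_eq_pathGraph, sub_self]
    exact zero_mem _
  · intro w
    rw [caterpillarRootPoly, pow_zero, one_mul, show w = ⟨w, by omega⟩ from rfl,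
      rootPoly_pathGraph (by omega)]
    exact pathPolys_mul_sub_center_mem_nonnegCoeff (by omega)

/-- Attaching a pendent vertex anywhere costs at least as much as attaching it at the centre of
the caterpillar. -/
theorem DominatesCaterpillar.addLeaf {d k : ℕ} {G : SimpleGraph V}
    (h : G.DominatesCaterpillar d k) (y : V) : (G.addLeaf y).DominatesCaterpillar d (k + 1) := by
  constructor
  · rw [lapPoly_addLeaf, lapPoly_caterpillar_succ, rootPoly_caterpillar]
    convert add_mem (mul_mem X_add_one_mem_nonnegCoeff h.1) (mul_mem X_mem_nonnegCoeff (h.2 y))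
      using 1
    ring
  · intro w
    convert add_mem (G.rootPoly_addLeaf_sub_mem_nonnegCoeff y w)
      (mul_mem X_add_one_mem_nonnegCoeff (h.2 (w.getD y))) using 1
    rw [caterpillarRootPoly, caterpillarRootPoly]
    ring

end Dominates

/-! ### Growing a tree from a path -/

section Trees

variable {V : Type*} {T : SimpleGraph V}

/-- In an acyclic graph, a vertex outside of a connected set has at most one neighbour in it. -/
theorem IsAcyclic.eq_of_adj_of_preconnected_induce (hT : T.IsAcyclic) {S : Set V}
    (hS : (T.induce S).Preconnected) {v y z : V} (hv : v ∉ S) (hy : y ∈ S) (hz : z ∈ S)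
    (hvy : T.Adj v y) (hvz : T.Adj v z) : z = y := by
  obtain ⟨p, hp⟩ := (hS ⟨y, hy⟩ ⟨z, hz⟩).exists_isPath
  have hq : (p.map (Embedding.induce S).toHom).IsPath :=
    hp.map (Embedding.induce (G := T) S).injective
  have hvq : v ∉ (p.map (Embedding.induce (G := T) S).toHom).support := by
    rw [Walk.support_map, List.mem_map]
    rintro ⟨x, -, rfl⟩
    exact hv x.2
  -- the edge from `v` to `z` and the detour through `y` and `S` are the same path
  have h := (hT.subsingleton_path v z).elim ⟨_, hq.cons (h := hvy) hvq⟩ (Path.singleton hvz)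
  have h0 : p.length = 0 := by
    have h1 : (p.map (Embedding.induce (G := T) S).toHom).length + 1 = 1 :=
      congrArg (fun p : T.Path v z => (p : T.Walk v z).length) h
    rw [Walk.length_map] at h1
    omega
  exact (congrArg Subtype.val (Walk.eq_of_length_eq_zero h0)).symm

theorem induce_insert_preconnected {S : Set V} (hS : (T.induce S).Preconnected) {v y : V}
    (hy : y ∈ S) (hvy : T.Adj v y) : (T.induce (insert v S)).Preconnected := by
  have key : ∀ x : ↥(insert v S), (T.induce (insert v S)).Reachable ⟨y, Or.inr hy⟩ x := by
    rintro ⟨x, hx | hx⟩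
    · subst hx
      exact Adj.reachable hvy.symm
    · exact (hS ⟨y, hy⟩ ⟨x, hx⟩).map (induceHomOfLE T (Set.subset_insert v S)).toHom
  exact fun a b => (key a).symm.trans (key b)

/-- Adding to a connected set of vertices of an acyclic graph a vertex adjacent to it attaches a
pendent vertex to the induced graph. -/
theorem IsAcyclic.nonempty_induce_insert_iso (hT : T.IsAcyclic) {S : Set V}
    (hS : (T.induce S).Preconnected) {v y : V} (hv : v ∉ S) (hy : y ∈ S) (hvy : T.Adj v y) :
    Nonempty ((T.induce S).addLeaf ⟨y, hy⟩ ≃g T.induce (insert v S)) := by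
  let f : Option S → ↥(insert v S) := fun o => o.elim ⟨v, Or.inl rfl⟩ fun s => ⟨s, Or.inr s.2⟩
  have hf : f.Bijective := by
    constructor
    · rintro (_ | a) (_ | b) h <;> have h' := Subtype.ext_iff.mp h
      · rfl
      · have h' : v = b := h'
        exact absurd b.2 (h' ▸ hv)
      · have h' : (a : V) = v := h'
        exact absurd a.2 (h' ▸ hv)
      · exact congrArg some (Subtype.ext h')
    · rintro ⟨x, hx | hx⟩
      · exact ⟨none, Subtype.ext hx.symm⟩
      · exact ⟨some ⟨x, hx⟩, rfl⟩
  refine ⟨addLeafIso (Equiv.ofBijective f hf) ⟨y, hy⟩ (fun i j => Iff.rfl) fun j => ?_⟩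
  refine ⟨fun h => Subtype.ext (hT.eq_of_adj_of_preconnected_induce hS hv hy j.2 hvy h), ?_⟩
  rintro rfl
  exact hvy

/-- A path in an acyclic graph is an induced path. -/
theorem IsAcyclic.nonempty_pathGraph_iso_induce (hT : T.IsAcyclic) {u v : V} {p : T.Walk u v}
    (hp : p.IsPath) : Nonempty (pathGraph (p.length + 1) ≃g T.induce p.toSubgraph.verts) := by
  have hconn : p.toSubgraph.coe.Connected := p.toSubgraph_connected.coe
  have hle : p.toSubgraph.coe ≤ T.induce p.toSubgraph.verts := fun a b h => p.toSubgraph.adj_sub h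
  have htree : (T.induce p.toSubgraph.verts).IsTree := ⟨hconn.mono hle, hT.induce _⟩
  have heq : p.toSubgraph.coe = T.induce p.toSubgraph.verts :=
    le_antisymm hle ((isTree_iff_minimal_connected.mp htree).2 hconn hle)
  classical
  exact ⟨heq ▸ hp.pathGraphIsoToSubgraph⟩

variable [Fintype V] [DecidableEq V]

theorem IsTree.dominatesCaterpillar_of_induce (hT : T.IsTree) {d m k : ℕ} {S : Set V}
    [Fintype S] [DecidableEq S] (hne : S.Nonempty) (hS : (T.induce S).Preconnected)
    (hdom : (T.induce S).DominatesCaterpillar d k) (hm : Sᶜ.ncard = m) :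
    T.DominatesCaterpillar d (k + m) := by
  induction m generalizing S k with
  | zero =>
    have : S = Set.univ := by
      rwa [Set.ncard_eq_zero, Set.compl_empty_iff] at hm
    subst this
    exact hdom.iso (induceUnivIso T)
  | succ m ih =>
    obtain ⟨a, ha⟩ := hne
    obtain ⟨b, hb⟩ : Sᶜ.Nonempty := by
      rw [← Set.ncard_pos, hm]; omega
    -- some edge leads from `S` to its complement
    obtain ⟨w⟩ := hT.connected a b
    obtain ⟨e, -, he1, he2⟩ := w.exists_boundary_dart S ha hb
    obtain ⟨φ⟩ := hT.isAcyclic.nonempty_induce_insert_iso hS he2 he1 e.adj.symm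
    classical
    rw [show k + (m + 1) = k + 1 + m by omega]
    refine ih (S := insert e.snd S) ⟨a, Or.inr ha⟩
      (induce_insert_preconnected hS he1 e.adj.symm) ((hdom.addLeaf _).iso φ) ?_
    have : Sᶜ = insert e.snd (insert e.snd S)ᶜ := by
      ext x
      by_cases hx : x = e.snd
      · subst hx; simpa using he2
      · simp [hx]
    rw [this, Set.ncard_insert_of_notMem (by simp)] at hm
    omega

/-- A tree that contains a path with `d` edges dominates the caterpillar `C_{n,d}` on equally many
vertices: it grows from that path by successively attaching pendent vertices. -/
theorem IsTree.dominatesCaterpillar (hT : T.IsTree) {d k : ℕ} {u v : V} {p : T.Walk u v}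
    (hp : p.IsPath) (hd : p.length = d) (hk : Fintype.card V = d + 1 + k) :
    T.DominatesCaterpillar d k := by
  classical
  subst hd
  obtain ⟨φ⟩ := hT.isAcyclic.nonempty_pathGraph_iso_induce hp
  have hcard : p.toSubgraph.verts.ncard = p.length + 1 := by
    rw [← Nat.card_coe_set_eq, ← Nat.card_congr φ.toEquiv, Nat.card_eq_fintype_card,
      Fintype.card_fin]
  have hm : p.toSubgraph.vertsᶜ.ncard = k := by
    have := Set.ncard_add_ncard_compl p.toSubgraph.verts
    rw [hcard, Nat.card_eq_fintype_card, hk] at this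
    omega
  have := hT.dominatesCaterpillar_of_induce ⟨u, p.start_mem_verts_toSubgraph⟩
    (φ.connected_iff.mp (pathGraph_connected _)).preconnected
    ((dominatesCaterpillar_pathGraph _).iso φ) hm
  rwa [zero_add] at this

/-- A tree that contains a path with `d` edges has Laplacian coefficients at least as large as those
of the caterpillar `C_{n,d}`. -/
theorem IsTree.lapCoeff_caterpillar_le (hT : T.IsTree) {n d k : ℕ} {u v : V} {p : T.Walk u v}
    (hp : p.IsPath) (hd : p.length = d) (hn : Fintype.card V = n) (hk : k ≤ n) :
    lapCoeff (caterpillar n d) k ≤ lapCoeff T k := by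
  subst hn
  obtain ⟨m, hm⟩ := Nat.exists_eq_add_of_le (show d + 1 ≤ Fintype.card V from hd ▸ hp.length_lt)
  have h := (hT.dominatesCaterpillar hp hd hm).1 (Fintype.card V - k)
  rw [lapCoeff_eq_coeff _ hk, lapCoeff_eq_coeff _ (by rwa [Fintype.card_fin]), Fintype.card_fin]
  rw [coeff_sub, ← hm] at h
  exact sub_nonneg.mp h

end Trees

/-! ### The tree structure and the diameter of the caterpillar -/

theorem exists_walk_caterpillar_length_eq {n d : ℕ} {i j : Fin n} (hij : i ≤ j) (hj : (j : ℕ) ≤ d) :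
    ∃ w : (caterpillar n d).Walk i j, w.length = (j : ℕ) - i := by
  obtain ⟨m, hm⟩ := Nat.exists_eq_add_of_le (Fin.le_def.mp hij)
  induction m generalizing j with
  | zero =>
    obtain rfl : j = i := Fin.ext hm
    exact ⟨Walk.nil, by simp⟩
  | succ m ih =>
    have hlt : (i : ℕ) + m < n := by have := j.2; omega
    obtain ⟨w, hw⟩ := ih (j := ⟨i + m, hlt⟩) (Fin.le_def.mpr (by simp)) (by simp; omega) rfl
    have hadj : (caterpillar n d).Adj ⟨i + m, hlt⟩ j := by
      rw [caterpillar_adj]; simp only; omega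
    refine ⟨w.concat hadj, ?_⟩
    rw [Walk.length_concat, hw]
    simp only
    omega

/-- Any two vertices of the caterpillar are joined by a walk of length at most `d`. -/
theorem exists_walk_caterpillar_length_le {n d : ℕ} (hd : 2 ≤ d) (i j : Fin n) :
    ∃ w : (caterpillar n d).Walk i j, w.length ≤ d := by
  wlog hij : i ≤ j generalizing i j
  · obtain ⟨w, hw⟩ := this j i (le_of_not_ge hij)
    exact ⟨w.reverse, by rwa [Walk.length_reverse]⟩
  rw [Fin.le_def] at hij
  by_cases hjd : (j : ℕ) ≤ d
  · obtain ⟨w, hw⟩ := exists_walk_caterpillar_length_eq (Fin.le_def.mpr hij) hjd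
    exact ⟨w, by omega⟩
  · have hn := j.2
    let c : Fin n := ⟨d / 2, by omega⟩
    have hcj : (caterpillar n d).Adj c j :=
      caterpillar_adj.mpr (Or.inr (Or.inl ⟨rfl, by omega⟩))
    suffices ∃ w : (caterpillar n d).Walk i c, w.length + 1 ≤ d by
      obtain ⟨w, hw⟩ := this
      exact ⟨w.concat hcj, by rwa [Walk.length_concat]⟩
    by_cases hid : (i : ℕ) ≤ d
    · rcases le_total i c with h | h
      · obtain ⟨w, hw⟩ := exists_walk_caterpillar_length_eq (d := d) h (by simp only [c]; omega)
        exact ⟨w, by simp only [c] at hw; omega⟩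
      · obtain ⟨w, hw⟩ := exists_walk_caterpillar_length_eq h hid
        exact ⟨w.reverse, by rw [Walk.length_reverse]; simp only [c] at hw; omega⟩
    · have hci : (caterpillar n d).Adj i c :=
        caterpillar_adj.mpr (Or.inr (Or.inr (Or.inr ⟨rfl, by omega⟩)))
      exact ⟨Walk.cons hci Walk.nil, by simpa using hd⟩

theorem caterpillar_connected {n d : ℕ} (hd : 2 ≤ d) (hn : d + 1 ≤ n) :
    (caterpillar n d).Connected :=
  have : Nonempty (Fin n) := ⟨⟨0, by omega⟩⟩
  ⟨fun i j => (exists_walk_caterpillar_length_le hd i j).elim fun w _ => ⟨w⟩⟩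

/-- Every edge of the caterpillar joins a vertex `v ≠ 0` to its parent, which is `v - 1` on the path
and `d / 2` for the other vertices. So there are at most `n - 1` edges. -/
theorem caterpillar_isTree {n d : ℕ} (hd : 2 ≤ d) (hn : d + 1 ≤ n) :
    (caterpillar n d).IsTree := by
  classical
  have hc := caterpillar_connected hd hn
  rw [isTree_iff_connected_and_card]
  refine ⟨hc, le_antisymm ?_ hc.card_vert_le_card_edgeSet_add_one⟩
  let parent : Fin n → Fin n := fun v =>
    if (v : ℕ) ≤ d then ⟨v - 1, by omega⟩ else ⟨d / 2, by omega⟩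
  let z : Fin n := ⟨0, by omega⟩
  have hsub : (caterpillar n d).edgeSet ⊆
      ((Finset.univ.erase z).image fun v => s(v, parent v) : Finset (Sym2 (Fin n))) := by
    intro e
    induction e using Sym2.ind with
    | _ i j =>
    intro h
    rw [mem_edgeSet, caterpillar_adj] at h
    rw [Finset.mem_coe, Finset.mem_image]
    by_cases hij : ((i : ℕ) + 1 = j ∧ (j : ℕ) ≤ d) ∨ ((i : ℕ) = d / 2 ∧ d < (j : ℕ))
    · refine ⟨j, by simp only [z, Finset.mem_erase, ne_eq, Fin.ext_iff]; simp; omega, ?_⟩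
      rw [Sym2.eq_swap]
      congr 2
      simp only [parent, Fin.ext_iff]
      split_ifs <;> simp only <;> omega
    · refine ⟨i, by simp only [z, Finset.mem_erase, ne_eq, Fin.ext_iff]; simp; omega, ?_⟩
      congr 2
      simp only [parent, Fin.ext_iff]
      split_ifs <;> simp only <;> omega
  have h1 := Set.ncard_le_ncard hsub (Finset.finite_toSet _)
  rw [Set.ncard_coe_finset] at h1
  have h2 := h1.trans Finset.card_image_le
  rw [Finset.card_erase_of_mem (Finset.mem_univ _), Finset.card_univ, Fintype.card_fin] at h2
  rw [Nat.card_coe_set_eq, Nat.card_eq_fintype_card, Fintype.card_fin]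
  omega

/-- The position along the path, where the pendent vertices count as the central vertex, changes
by at most one along every edge. -/
theorem le_add_length_of_caterpillar_walk {n d : ℕ} {i j : Fin n} (w : (caterpillar n d).Walk i j) :
    (if (j : ℕ) ≤ d then (j : ℕ) else d / 2) ≤
      (if (i : ℕ) ≤ d then (i : ℕ) else d / 2) + w.length := by
  induction w with
  | nil => simp
  | cons h w ih =>
    refine ih.trans ?_
    rw [caterpillar_adj] at h
    rw [Walk.length_cons]
    split_ifs <;> omega

theorem le_dist_caterpillar {n d : ℕ} (hd : 2 ≤ d) (hn : d + 1 ≤ n) {i : ℕ} (hi : i ≤ d) :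
    i ≤ (caterpillar n d).dist ⟨0, by omega⟩ ⟨i, by omega⟩ := by
  obtain ⟨w, hw⟩ := (caterpillar_connected hd hn).exists_walk_length_eq_dist
    ⟨0, by omega⟩ ⟨i, by omega⟩
  have := le_add_length_of_caterpillar_walk w
  simpa [hi, hw] using this

theorem caterpillar_diam {n d : ℕ} (hd : 2 ≤ d) (hn : d + 1 ≤ n) : (caterpillar n d).diam = d := by
  have : Nonempty (Fin n) := ⟨⟨0, by omega⟩⟩
  apply le_antisymm
  · obtain ⟨i, j, hij⟩ := (caterpillar n d).exists_dist_eq_diam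
    obtain ⟨w, hw⟩ := exists_walk_caterpillar_length_le hd i j
    rw [← hij]
    exact (dist_le w).trans hw
  · exact (le_dist_caterpillar hd hn le_rfl).trans
      (dist_le_diam (connected_iff_ediam_ne_top.mp (caterpillar_connected hd hn)))

/-! ### Stars -/

/-- Exchanging the vertices `r` and `1` maps the star with centre `r` to the caterpillar. -/
def starGraphIso {n : ℕ} (hn : 3 ≤ n) (r : Fin n) : starGraph r ≃g caterpillar n 2 where
  toEquiv := Equiv.swap r ⟨1, by omega⟩
  map_rel_iff' := by
    intro i j
    have key : ∀ a b : Fin n, (caterpillar n 2).Adj a b ↔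
        a ≠ b ∧ (a = ⟨1, by omega⟩ ∨ b = ⟨1, by omega⟩) := by
      intro a b
      rw [caterpillar_adj]
      simp only [ne_eq, Fin.ext_iff]
      omega
    rw [key, starGraph_adj, (Equiv.swap r _).injective.ne_iff]
    simp only [Equiv.swap_apply_eq_iff, Equiv.swap_apply_right]

end SimpleGraph

theorem mainTheorem1 (n : ℕ) :
    -- for `2 ≤ d ≤ n - 1`, the caterpillar is itself a tree on `n` vertices with diameter `d`
    (∀ d : ℕ, 2 ≤ d → d + 1 ≤ n → (caterpillar n d).IsTree ∧ (caterpillar n d).diam = d) ∧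
    -- it minimizes every Laplacian coefficient among the trees on `n` vertices with diameter `d`
    (∀ (d : ℕ) {V : Type*} [Fintype V] [DecidableEq V] (T : SimpleGraph V),
      Fintype.card V = n → T.IsTree → T.diam = d →
        ∀ k : ℕ, k ≤ n → lapCoeff (caterpillar n d) k ≤ lapCoeff T k) ∧
    -- `c_k(S_n) = c_k(C_{n,2}) ≤ c_k(C_{n,3}) ≤ … ≤ c_k(C_{n,n-1}) = c_k(P_n)`
    (3 ≤ n → ∀ k : ℕ, k ≤ n →
      (∀ r : Fin n, lapCoeff (SimpleGraph.starGraph r) k = lapCoeff (caterpillar n 2) k) ∧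
      (∀ d : ℕ, 2 ≤ d → d + 2 ≤ n →
        lapCoeff (caterpillar n d) k ≤ lapCoeff (caterpillar n (d + 1)) k) ∧
      lapCoeff (caterpillar n (n - 1)) k = lapCoeff (SimpleGraph.pathGraph n) k) := by
  refine ⟨fun d hd hn =>
    ⟨SimpleGraph.caterpillar_isTree hd hn, SimpleGraph.caterpillar_diam hd hn⟩, ?_, ?_⟩
  · intro d V _ _ T hcard hT hdiam k hk
    have := hT.connected.nonempty
    obtain ⟨u, v, huv⟩ := T.exists_dist_eq_diam
    obtain ⟨p, hp, hlen⟩ := hT.connected.exists_path_of_dist u v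
    exact hT.lapCoeff_caterpillar_le hp (hlen.trans (huv.trans hdiam)) hcard hk
  · intro hn k hk
    refine ⟨fun r => SimpleGraph.lapCoeff_iso (SimpleGraph.starGraphIso hn r)
      (by rwa [Fintype.card_fin]), ?_, ?_⟩
    · intro d hd hdn
      have hT := SimpleGraph.caterpillar_isTree (n := n) (d := d + 1) (by omega) (by omega)
      -- the first `d` edges of the path of length `d + 1` form a path of length `d`
      let u : Fin n := ⟨0, by omega⟩
      let v : Fin n := ⟨d, by omega⟩
      obtain ⟨p, hp, hlen⟩ := hT.connected.exists_path_of_dist u v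
      refine hT.lapCoeff_caterpillar_le hp (le_antisymm ?_ ?_) (Fintype.card_fin n) hk
      · obtain ⟨w, hw⟩ := SimpleGraph.exists_walk_caterpillar_length_eq
          (n := n) (d := d + 1) (i := u) (j := v)
          (Fin.le_def.mpr (Nat.zero_le _)) (Nat.le_succ d)
        exact hlen.trans_le ((SimpleGraph.dist_le w).trans_eq hw)
      · exact (SimpleGraph.le_dist_caterpillar (by omega) (by omega)
          (Nat.le_succ d)).trans_eq hlen.symm
    · obtain ⟨m, rfl⟩ := Nat.exists_eq_add_of_le' (show 1 ≤ n by omega)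
      rw [Nat.add_sub_cancel, SimpleGraph.caterpillar_eq_pathGraph]
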